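/- Let $n\ge 1$ and $p\in[0,1]$. In the planted distribution, an assignment $\varphi\in\{\mathrm{TRUE},\mathrm{FALSE}\}^n$ to the variables $x_1,\dots,x_n$ is chosen uniformly at random, and then every 3-clause (a disjunction of three literals over three different variables) that is satisfied by $\varphi$ is included in the formula $\mathcal F$ independently with probability $p$. Warning Propagation (WP) on $\mathcal F$ keeps a message $C\to x\in\{0,1\}$ for every clause $C$ of $\mathcal F$ and every variable $x$ of $C$; initially these are independent fair random bits. In each iteration a fresh uniformly random order of all pairs $(C,x)$ is drawn, and in this order the messages are recomputed one after another from the latest values of the others: with $$ y\to C=\sum_{D\ne C,\ y\in D} (D\to y)\;-\sum_{D\neq C,\ \bar y\in D}(D\to y),$$ where $D$ ranges over the clauses of $\mathcal F$, the new value of $C\to x$ is $1$ if $y\to C<0$ for every positive literal $y\ne x$ of $C$ and $y\to C>0$ for every negative literal $\bar y$ of $C$ with $y\neq x$, and it is $0$ otherwise. The iterations stop after the first iteration at whose end all messages have the same values as before that iteration; if this happens, WP is said to converge. It then returns the partial assignment $\psi$ in which $x_i$ is TRUE, FALSE or UNASSIGNED according to whether $$B_i=\sum_{D\ni x_i}(D\to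 x_i)-\sum_{D\ni \bar x_i}(D\to x_i)$$ is positive, negative or zero. There is a constant $c_0>0$ such that for every $c\ge c_0$ and every $p=p(n)\in[0,1]$ with $p(n)\ge c\log n/n^2$ for all sufficiently large $n$, the following holds with probability tending to $1$ as $n\to\infty$ (over $\varphi$, $\mathcal F$, the initial messages and the edge orders): WP on $\mathcal F$ converges after at most $2$ iterations (counting the last one, in which no message changes), and the returned $\psi$ equals $\varphi$. -/

import Mathlib

open Filter Topology

namespace WarningPropagation

/-- A literal over the variables `x_0, …, x_{n-1}`: `(i, true)` is the literal `x_i`, and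
`(i, false)` is its negation. -/
abbrev Literal (n : ℕ) := Fin n × Bool

/-- A 3-clause: a set of three literals over three different variables. -/
abbrev Clause (n : ℕ) :=
  {C : Finset (Literal n) // C.card = 3 ∧ ∀ l ∈ C, ∀ l' ∈ C, l.1 = l'.1 → l = l'}

/-- A 3CNF formula is a set of 3-clauses. -/
abbrev Formula (n : ℕ) := Finset (Clause n)

/-- A truth assignment. -/
abbrev Assignment (n : ℕ) := Fin n → Bool

/-- A partial assignment; the value `none` means UNASSIGNED. -/
abbrev PartialAssignment (n : ℕ) := Fin n → Option Bool

/-- `φ` satisfies `C` if some literal of `C` is true under `φ`. -/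
def Satisfies {n : ℕ} (φ : Assignment n) (C : Clause n) : Prop :=
  ∃ l ∈ C.1, φ l.1 = l.2

instance {n : ℕ} (φ : Assignment n) (C : Clause n) : Decidable (Satisfies φ C) := by
  unfold Satisfies; infer_instance

/-- The set of all clauses over `n` variables that `φ` satisfies. -/
def satisfiedClauses {n : ℕ} (φ : Assignment n) : Finset (Clause n) :=
  Finset.univ.filter (Satisfies φ)

/-- The probability of the formula `F` when each clause satisfied by `φ` is included
independently with probability `p` and no other clause is included. -/
noncomputable def plantedWeight {n : ℕ} (p : unitInterval) (φ : Assignment n)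
    (F : Formula n) : ENNReal :=
  if F ⊆ satisfiedClauses φ then
    ENNReal.ofReal (p : ℝ) ^ F.card *
      ENNReal.ofReal (1 - (p : ℝ)) ^ ((satisfiedClauses φ).card - F.card)
  else 0

theorem sum_plantedWeight {n : ℕ} (p : unitInterval) (φ : Assignment n) :
    ∑ F : Formula n, plantedWeight p φ F = 1 := by
  have h : (Finset.univ.filter fun F : Formula n => F ⊆ satisfiedClauses φ) =
      (satisfiedClauses φ).powerset := by
    ext F; simp
  unfold plantedWeight
  rw [← Finset.sum_filter, h, Finset.sum_pow_mul_eq_add_pow,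
    ← ENNReal.ofReal_add p.2.1 (sub_nonneg.2 p.2.2)]
  simp

/-- The law of the random formula with planted assignment `φ`. -/
noncomputable def plantedFormula {n : ℕ} (p : unitInterval) (φ : Assignment n) :
    PMF (Formula n) :=
  PMF.ofFintype (plantedWeight p φ) (sum_plantedWeight p φ)

/-- The (clause-variable) edges of the factor graph of `F`: pairs `(C, x)` with `C` a clause
of `F` and `x` a variable that appears in `C`. -/
abbrev Edge {n : ℕ} (F : Formula n) :=
  {e : Clause n × Fin n // e.1 ∈ F ∧ e.2 ∈ e.1.1.image Prod.fst}

instance {n : ℕ} : DecidableEq (Clause n) := Subtype.instDecidableEq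

instance {n : ℕ} (F : Formula n) : DecidableEq (Edge F) := Subtype.instDecidableEq

instance {n : ℕ} (F : Formula n) : Fintype (Edge F) := Subtype.fintype _

/-- A vector of clause-variable messages; `true` stands for the value 1 (a warning). -/
abbrev Messages {n : ℕ} (F : Formula n) := Edge F → Bool

/-- The sum of the messages `D → x` over the clauses `D ∈ S` in which the variable `x` of the
literal `l` appears as the literal `l`. -/
def received {n : ℕ} {F : Formula n} (α : Messages F) (S : Formula n) (l : Literal n) : ℤ :=
  ∑ e : Edge F with e.1.1 ∈ S ∧ e.1.2 = l.1 ∧ l ∈ e.1.1.1, if α e = true then 1 else 0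

/-- The variable-clause message `x → C`. -/
def varMessage {n : ℕ} {F : Formula n} (α : Messages F) (x : Fin n) (C : Clause n) : ℤ :=
  received α (F.erase C) (x, true) - received α (F.erase C) (x, false)

/-- The clause-variable message `C → x` computed from the current messages: it is 1 iff
`y → C` is negative for every other positive literal `y` of `C`, and positive for every
other negative literal of `C`. -/
def clauseMessage {n : ℕ} {F : Formula n} (α : Messages F) (C : Clause n) (x : Fin n) : Bool :=
  decide (∀ l ∈ C.1, l.1 ≠ x →
    if l.2 = true then varMessage α l.1 C < 0 else 0 < varMessage α l.1 C)

/-- Update the message along one edge, on the basis of the current values of the others. -/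
def updateEdge {n : ℕ} {F : Formula n} (α : Messages F) (e : Edge F) : Messages F :=
  Function.update α e (clauseMessage α e.1.1 e.1.2)

/-- An ordering of the edges of the factor graph of `F`. -/
abbrev EdgeOrder {n : ℕ} (F : Formula n) := Fin (Fintype.card (Edge F)) ≃ Edge F

instance {n : ℕ} (F : Formula n) : Nonempty (EdgeOrder F) :=
  ⟨(Fintype.equivFin (Edge F)).symm⟩

/-- One iteration: all messages are updated one after the other, in the order `π`. -/
def iteration {n : ℕ} {F : Formula n} (π : EdgeOrder F) (α : Messages F) : Messages F :=
  (List.ofFn π).foldl updateEdge α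

/-- The value `B_x` at the variable `x`. -/
def bias {n : ℕ} {F : Formula n} (α : Messages F) (x : Fin n) : ℤ :=
  received α F (x, true) - received α F (x, false)

/-- The partial assignment determined by the signs of the values `B_x`. -/
def toPartialAssignment {n : ℕ} {F : Formula n} (α : Messages F) : PartialAssignment n :=
  fun x => if 0 < bias α x then some true else if bias α x < 0 then some false else none

/-- The main loop, started from the messages `α` and cut off after `T` iterations: each
iteration uses a fresh uniformly random edge order; as soon as an iteration has changed no
message, the loop ends and the partial assignment is returned. The output `none` means that
the loop has not ended within `T` iterations. -/
noncomputable def loop {n : ℕ} {F : Formula n} :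
    ℕ → Messages F → PMF (Option (PartialAssignment n))
  | 0, _ => PMF.pure none
  | T + 1, α =>
    (PMF.uniformOfFintype (EdgeOrder F)).bind fun π =>
      if iteration π α = α then PMF.pure (some (toPartialAssignment (iteration π α)))
      else loop T (iteration π α)

/-- The output of Warning Propagation on `F`, cut off after `T` iterations. The initial
messages are independent fair bits. -/
noncomputable def warningPropagation {n : ℕ} (F : Formula n) (T : ℕ) :
    PMF (Option (PartialAssignment n)) :=
  (PMF.uniformOfFintype (Messages F)).bind fun α => loop T α

/-- The joint law of the uniformly random planted assignment `φ` and of the output of Warning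
Propagation, cut off after `T` iterations, on a random formula with planted assignment `φ`. -/
noncomputable def plantedRun (n : ℕ) (p : unitInterval) (T : ℕ) :
    PMF (Assignment n × Option (PartialAssignment n)) :=
  (PMF.uniformOfFintype (Assignment n)).bind fun φ =>
    (plantedFormula p φ).bind fun F =>
      (warningPropagation F T).map fun out => (φ, out)

/-- The event that the run has converged and the returned partial assignment is `φ`. -/
def recoversPlanted (n : ℕ) : Set (Assignment n × Option (PartialAssignment n)) :=
  {ω | ω.2 = some fun x => some (ω.1 x)}

end WarningPropagation

/-! Under `φ`, the warning on an edge `(C, y)` is justified exactly when every other literal of `C`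
is false; `target` is the vector of justified warnings. Suppose that at every variable the messages
point towards `φ` by a margin of at least 2. Ignoring one clause costs at most 1, so every `y → C`
has the sign of `φ y`, and the next update writes the target value (`clauseMessage_eq_target`). If
the margins stay at least 2 throughout the first iteration, it ends at `target`, a fixed point whose
biases have the signs of `φ`, and a second iteration changes nothing.

It remains to bound the margins at each time `k` of the first iteration. At `y`, edges fall into
three kinds. Support edges (`y` is the only true literal) end at 1 and give a positive drift of
order `q = p * n ^ 2`. True edges (another literal is true as well) and false edges (`y` is false)
start as fair bits, end at 0, and contribute with opposite signs. Negating the literal of `y`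
matches the possible clauses of the last two kinds, so in a typical formula the false edges
outnumber the true ones by at most a small fraction of `q` (`Typical`).

For a typical formula, `exp (-s * margin)` is averaged over the initial bits and the order. The bits
are independent, so their average factors over edges. The order is not, but pairing a false edge
with a true one and exchanging their positions bounds the average (`sum_prod_lateWeight_le`): a pair
costs only `s ^ 2 / 4` in the exponent, against a gain of nearly `s / 2` per support edge. For small
constant `s` the moment is at most `exp (-q / 10 ^ 6)`, and a union bound over polynomially many
times and variables finishes the proof once `q` is a large multiple of `log n`. -/

namespace WarningPropagation

/-! ### Deterministic dynamics under large margins -/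

/-- The messages at which Warning Propagation stabilizes: the edge `(C, x)` carries a warning iff
every literal of `C` other than that of `x` is false under `φ`. -/
def target {n : ℕ} (φ : Assignment n) (F : Formula n) : Messages F := fun e =>
  decide (∀ l ∈ e.1.1.1, l.1 ≠ e.1.2 → φ l.1 ≠ l.2)

/-- The value `B_y`, counted positively if it points towards `φ y`. -/
def margin {n : ℕ} {F : Formula n} (φ : Assignment n) (α : Messages F) (y : Fin n) : ℤ :=
  received α F (y, φ y) - received α F (y, !φ y)

/-- The messages `α`, updated to their target value on the set `t`. -/
def hybrid {n : ℕ} {F : Formula n} (φ : Assignment n) (t : Finset (Edge F)) (α : Messages F) :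
    Messages F := fun e => if e ∈ t then target φ F e else α e

variable {n : ℕ} {F : Formula n}

theorem received_erase_le (α : Messages F) (C : Clause n) (l : Literal n) :
    received α (F.erase C) l ≤ received α F l := by
  unfold received
  apply Finset.sum_le_sum_of_subset_of_nonneg
  · intro e
    simp only [Finset.mem_filter, Finset.mem_univ, true_and, Finset.mem_erase]
    tauto
  · intros; split_ifs <;> simp

theorem received_le_erase_add_one (α : Messages F) (C : Clause n) (l : Literal n) :
    received α F l ≤ received α (F.erase C) l + 1 := by
  unfold received
  rw [← Finset.sum_filter_add_sum_filter_not (Finset.univ.filter fun e : Edge F =>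
    e.1.1 ∈ F ∧ e.1.2 = l.1 ∧ l ∈ e.1.1.1) (fun e => e.1.1 ≠ C)]
  apply add_le_add
  · apply Finset.sum_le_sum_of_subset_of_nonneg
    · intro e
      simp only [Finset.mem_filter, Finset.mem_univ, true_and, Finset.mem_erase]
      tauto
    · intros; split_ifs <;> simp
  · refine (Finset.sum_le_card_nsmul _ _ 1 ?_).trans ?_
    · intros; split_ifs <;> simp
    · simp only [nsmul_eq_mul, mul_one]
      norm_cast
      -- Only the edge joining `C` to the variable of `l` can be lost.
      apply Finset.card_le_one.2
      intro a ha b hb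
      simp only [Finset.mem_filter, Finset.mem_univ, true_and, not_not] at ha hb
      exact Subtype.ext (Prod.ext (ha.2.trans hb.2.symm) (ha.1.2.1.trans hb.1.2.1.symm))

/-- Erasing `C` lowers the margin by at most 1, so a margin of 2 leaves the sign strict. -/
theorem varMessage_pos_iff {φ : Assignment n} {α : Messages F} (h : ∀ y, 2 ≤ margin φ α y)
    (C : Clause n) (y : Fin n) : 0 < varMessage α y C ↔ φ y = true := by
  have h1 := h y
  have h2 := received_erase_le α C (y, !φ y)
  have h3 := received_le_erase_add_one α C (y, φ y)
  have h4 := received_erase_le α C (y, φ y)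
  have h5 := received_le_erase_add_one α C (y, !φ y)
  unfold margin at h1
  unfold varMessage
  cases hy : φ y <;> simp only [hy, Bool.not_true, Bool.not_false] at * <;> simp <;> omega

theorem varMessage_neg_iff {φ : Assignment n} {α : Messages F} (h : ∀ y, 2 ≤ margin φ α y)
    (C : Clause n) (y : Fin n) : varMessage α y C < 0 ↔ φ y = false := by
  have h1 := h y
  have h2 := received_erase_le α C (y, !φ y)
  have h3 := received_le_erase_add_one α C (y, φ y)
  have h4 := received_erase_le α C (y, φ y)
  have h5 := received_le_erase_add_one α C (y, !φ y)
  unfold margin at h1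
  unfold varMessage
  cases hy : φ y <;> simp only [hy, Bool.not_true, Bool.not_false] at * <;> simp <;> omega

theorem clauseMessage_eq_target {φ : Assignment n} {α : Messages F}
    (h : ∀ y, 2 ≤ margin φ α y) (e : Edge F) : clauseMessage α e.1.1 e.1.2 = target φ F e := by
  unfold clauseMessage target
  congr 1
  apply propext
  refine forall_congr' fun l => forall_congr' fun _ => forall_congr' fun _ => ?_
  rw [varMessage_pos_iff h, varMessage_neg_iff h]
  cases l.2 <;> cases φ l.1 <;> simp

/-- While margins are large, the state depends on the processed edges only as a set: each is at its
target, the rest still hold their initial bits. This makes the state at time `k` explicit, without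
tracking feedback between updates. -/
theorem foldl_updateEdge {φ : Assignment n} {α : Messages F} (L : List (Edge F))
    (h : ∀ k, ∀ y, 2 ≤ margin φ (hybrid φ (L.take k).toFinset α) y) :
    L.foldl updateEdge α = hybrid φ L.toFinset α := by
  induction L using List.reverseRecOn with
  | nil => funext e; simp [hybrid]
  | append_singleton L a ih =>
    have h' : ∀ k, ∀ y, 2 ≤ margin φ (hybrid φ (L.take k).toFinset α) y := by
      intro k
      rcases le_total k L.length with hk | hk
      · have := h k
        rwa [List.take_append_of_le_length hk] at this
      · have := h L.length
        rw [List.take_append_of_le_length le_rfl] at this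
        rwa [List.take_of_length_le hk, ← List.take_length (l := L)]
    have hL : ∀ y, 2 ≤ margin φ (hybrid φ L.toFinset α) y := by
      have := h' L.length
      rwa [List.take_length] at this
    rw [List.foldl_append, ih h']
    simp only [List.foldl_cons, List.foldl_nil, updateEdge, clauseMessage_eq_target hL]
    funext e
    by_cases he : e = a
    · subst he; simp [hybrid]
    · simp [hybrid, he]

/-- The edges that come among the first `k` in the order `π`. -/
def firstEdges (π : EdgeOrder F) (k : ℕ) : Finset (Edge F) :=
  Finset.univ.filter fun e => (π.symm e : ℕ) < k

theorem toFinset_take_ofFn (π : EdgeOrder F) (k : ℕ) :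
    ((List.ofFn π).take k).toFinset = firstEdges π k := by
  ext e
  simp only [List.mem_toFinset, firstEdges, Finset.mem_filter, Finset.mem_univ, true_and,
    List.mem_take_iff_getElem, List.getElem_ofFn, List.length_ofFn]
  constructor
  · rintro ⟨i, hi, rfl⟩
    simp; omega
  · intro h
    exact ⟨π.symm e, by have := (π.symm e).2; omega, by simp⟩

theorem hybrid_univ (φ : Assignment n) (α : Messages F) :
    hybrid φ Finset.univ α = target φ F := by
  funext e; simp [hybrid]

theorem hybrid_target (φ : Assignment n) (t : Finset (Edge F)) :
    hybrid φ t (target φ F) = target φ F := by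
  funext e; simp [hybrid]

/-- At every moment of an iteration with order `π` that starts from `α`, the messages received by
each variable point towards `φ`, by a margin of at least 2. -/
def Favourable (φ : Assignment n) (α : Messages F) (π : EdgeOrder F) : Prop :=
  ∀ k ≤ Fintype.card (Edge F), ∀ y, 2 ≤ margin φ (hybrid φ (firstEdges π k) α) y

theorem firstEdges_of_le (π : EdgeOrder F) {k : ℕ} (hk : Fintype.card (Edge F) ≤ k) :
    firstEdges π k = Finset.univ := by
  ext e
  have := (π.symm e).2
  simp [firstEdges]; omega

theorem iteration_eq_target {φ : Assignment n} {α : Messages F} {π : EdgeOrder F}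
    (h : Favourable φ α π) : iteration π α = target φ F := by
  unfold iteration
  rw [foldl_updateEdge (φ := φ)]
  · rw [← List.take_length (l := List.ofFn π), toFinset_take_ofFn, List.length_ofFn,
      firstEdges_of_le π le_rfl, hybrid_univ]
  · intro k
    rw [toFinset_take_ofFn]
    rcases le_total k (Fintype.card (Edge F)) with hk | hk
    · exact h k hk
    · have := h _ le_rfl
      rwa [firstEdges_of_le π le_rfl, ← firstEdges_of_le π hk] at this

theorem Favourable.margin_target {φ : Assignment n} {α : Messages F} {π : EdgeOrder F}
    (h : Favourable φ α π) (y : Fin n) : 2 ≤ margin φ (target φ F) y := by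
  have := h _ le_rfl y
  rwa [firstEdges_of_le π le_rfl, hybrid_univ] at this

theorem iteration_target {φ : Assignment n} (h : ∀ y, 2 ≤ margin φ (target φ F) y)
    (π : EdgeOrder F) : iteration π (target φ F) = target φ F :=
  iteration_eq_target fun k _ y => by rw [hybrid_target]; exact h y

theorem toPartialAssignment_target {φ : Assignment n} (h : ∀ y, 2 ≤ margin φ (target φ F) y) :
    toPartialAssignment (target φ F) = fun x => some (φ x) := by
  funext x
  have hx := h x
  unfold margin at hx
  unfold toPartialAssignment bias
  cases hφ : φ x <;> simp only [hφ, Bool.not_true, Bool.not_false] at hx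
  · rw [if_neg (by omega), if_pos (by omega)]
  · rw [if_pos (by omega)]

/-! ### Averages over random bits and random orders -/

section Averaging

variable {E : Type*} {m : ℕ}

/-- `c` if `e` is not among the first `k` elements in the order `π`, and `1` otherwise. -/
def lateWeight (k : ℕ) (c : ℝ) (π : Fin m ≃ E) (e : E) : ℝ :=
  if (π.symm e : ℕ) < k then 1 else c

theorem lateWeight_nonneg (k : ℕ) {c : ℝ} (hc : 0 ≤ c) (π : Fin m ≃ E) (e : E) :
    0 ≤ lateWeight k c π e := by
  unfold lateWeight; split_ifs <;> simp [hc]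

theorem lateWeight_le_one (k : ℕ) {c : ℝ} (hc : c ≤ 1) (π : Fin m ≃ E) (e : E) :
    lateWeight k c π e ≤ 1 := by
  unfold lateWeight; split_ifs <;> simp [hc]

theorem lateWeight_le (k : ℕ) {c : ℝ} (hc : 1 ≤ c) (π : Fin m ≃ E) (e : E) :
    lateWeight k c π e ≤ c := by
  unfold lateWeight; split_ifs <;> simp [hc]

theorem lateWeight_swap [DecidableEq E] (k : ℕ) (c : ℝ) (π : Fin m ≃ E) (x y e : E) :
    lateWeight k c (π.trans (Equiv.swap x y)) e = lateWeight k c π (Equiv.swap x y e) := by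
  unfold lateWeight
  rw [Equiv.symm_trans_apply, Equiv.symm_swap]

theorem sum_eq_sum_add_sum {s t u : Finset E} (f : E → ℤ) (hst : Disjoint s t)
    (hu : ∀ e, e ∈ u ↔ e ∈ s ∨ e ∈ t) : ∑ e ∈ u, f e = ∑ e ∈ s, f e + ∑ e ∈ t, f e := by
  classical
  rw [← Finset.sum_union hst]
  exact Finset.sum_congr (by ext e; simp [hu]) fun _ _ => rfl

variable [Fintype E] [DecidableEq E]

theorem prod_ite_mem_mul (s t u : Finset E) (f g h : E → ℝ) :
    ∏ e, ((if e ∈ s then f e else 1) * (if e ∈ t then g e else 1) *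
      (if e ∈ u then h e else 1)) = (∏ e ∈ s, f e) * (∏ e ∈ t, g e) * ∏ e ∈ u, h e := by
  simp only [Finset.prod_mul_distrib, Finset.prod_ite_mem, Finset.univ_inter]

theorem prod_ite_exp (s t u : Finset E) (x : ℝ) (α : E → Bool) :
    ∏ e, (if α e = true then (if e ∈ s then Real.exp (-x) else 1) *
      (if e ∈ t then Real.exp (-x) else 1) * (if e ∈ u then Real.exp x else 1) else 1) =
    Real.exp (-x * (((∑ e ∈ s, if α e = true then 1 else 0) +
      (∑ e ∈ t, if α e = true then 1 else 0) - ∑ e ∈ u, if α e = true then 1 else 0 : ℤ) : ℝ)) := by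
  have key : ∀ e, (if α e = true then (if e ∈ s then Real.exp (-x) else 1) *
      (if e ∈ t then Real.exp (-x) else 1) * (if e ∈ u then Real.exp x else 1) else 1) =
      (if e ∈ s then Real.exp (if α e = true then -x else 0) else 1) *
      (if e ∈ t then Real.exp (if α e = true then -x else 0) else 1) *
      (if e ∈ u then Real.exp (if α e = true then x else 0) else 1) := by
    intro e
    cases α e <;> simp
  simp only [key, prod_ite_mem_mul, ← Real.exp_sum, ← Real.exp_add]
  congr 1
  push_cast
  rw [mul_sub, mul_add, Finset.mul_sum, Finset.mul_sum, Finset.mul_sum, sub_eq_add_neg,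
    ← Finset.sum_neg_distrib]
  simp [neg_ite]

theorem prod_two_mul (f : E → ℝ) : ∏ e, (2 * f e) = Fintype.card (E → Bool) * ∏ e, f e := by
  rw [Finset.prod_mul_distrib, Finset.prod_const, Finset.card_univ, Fintype.card_fun,
    Fintype.card_bool]
  norm_num

theorem sum_prod_bool (g : E → Bool → ℝ) :
    ∑ α : E → Bool, ∏ e, g e (α e) = ∏ e, ∑ v, g e v := by
  rw [Finset.prod_univ_sum, Fintype.piFinset_univ]

theorem sum_comp_swap (f : (Fin m ≃ E) → ℝ) (x y : E) :
    ∑ π : Fin m ≃ E, f (π.trans (Equiv.swap x y)) = ∑ π : Fin m ≃ E, f π :=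
  Equiv.sum_comp (Equiv.equivCongr (Equiv.refl (Fin m)) (Equiv.swap x y)) f

/-- `P` and `Q` will be the true and false edges, with `a` and `b` the average factors of an edge
not yet updated. Match elements of `Q` with elements of `P`: a matched pair costs `a * b` on
average, an unmatched element of `Q` at most `b`, an unmatched element of `P` at most 1. The
truncated subtraction counts the unmatched part of `Q`. -/
theorem sum_prod_lateWeight_le (k : ℕ) {a b : ℝ} (ha : 0 ≤ a) (ha1 : a ≤ 1) (hb : 1 ≤ b)
    (hab : a + b = 2 * (a * b)) (hab1 : 1 ≤ a * b) (P Q : Finset E) (hPQ : Disjoint P Q) :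
    ∑ π : Fin m ≃ E, (∏ e ∈ P, lateWeight k a π e) * ∏ e ∈ Q, lateWeight k b π e ≤
      Fintype.card (Fin m ≃ E) * ((a * b) ^ Q.card * b ^ (Q.card - P.card)) := by
  have hb0 : 0 ≤ b := zero_le_one.trans hb
  induction Q using Finset.induction_on generalizing P with
  | empty =>
    simp only [Finset.prod_empty, mul_one, Finset.card_empty, pow_zero, zero_tsub]
    refine (Finset.sum_le_card_nsmul _ _ 1 fun π _ => ?_).trans (by simp)
    exact Finset.prod_le_one (fun e _ => lateWeight_nonneg k ha π e)
      fun e _ => lateWeight_le_one k ha1 π e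
  | insert f Q hf ih =>
    rw [Finset.disjoint_insert_right] at hPQ
    rcases P.eq_empty_or_nonempty with rfl | ⟨e, he⟩
    · have := ih ∅ (Finset.disjoint_empty_left _)
      simp only [Finset.prod_empty, one_mul, Finset.card_empty, tsub_zero] at this ⊢
      rw [Finset.card_insert_of_notMem hf]
      calc _ ≤ ∑ π : Fin m ≃ E, b * ∏ e ∈ Q, lateWeight k b π e := by
            refine Finset.sum_le_sum fun π _ => ?_
            rw [Finset.prod_insert hf]
            exact mul_le_mul_of_nonneg_right (lateWeight_le k hb π f)
              (Finset.prod_nonneg fun e _ => lateWeight_nonneg k hb0 π e)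
        _ ≤ b * (Fintype.card (Fin m ≃ E) * ((a * b) ^ Q.card * b ^ Q.card)) := by
            rw [← Finset.mul_sum]
            exact mul_le_mul_of_nonneg_left this hb0
        -- An unmatched element needs only `b`; the spare factor `a * b ≥ 1` keeps the exponent
        -- uniform.
        _ ≤ (a * b) * (b * (Fintype.card (Fin m ≃ E) * ((a * b) ^ Q.card * b ^ Q.card))) :=
            le_mul_of_one_le_left (by positivity) hab1
        _ = _ := by ring
    · obtain ⟨P, heP, rfl⟩ : ∃ P', e ∉ P' ∧ P = insert e P' :=
        ⟨P.erase e, Finset.notMem_erase e P, (Finset.insert_erase he).symm⟩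
      rw [Finset.disjoint_insert_left] at hPQ
      have hfP : f ∉ P := fun h => hPQ.1 (Finset.mem_insert_of_mem h)
      have hef : e ≠ f := fun h => hPQ.1 (h ▸ Finset.mem_insert_self _ _)
      set g : (Fin m ≃ E) → ℝ := fun π =>
        (∏ e ∈ P, lateWeight k a π e) * ∏ e ∈ Q, lateWeight k b π e with hg
      have hg0 : ∀ π, 0 ≤ g π := fun π => mul_nonneg
        (Finset.prod_nonneg fun e _ => lateWeight_nonneg k ha π e)
        (Finset.prod_nonneg fun e _ => lateWeight_nonneg k hb0 π e)
      have hgs : ∀ π, g (π.trans (Equiv.swap e f)) = g π := by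
        intro π
        simp only [hg, lateWeight_swap]
        congr 1 <;> refine Finset.prod_congr rfl fun x hx => ?_
        · rw [Equiv.swap_apply_of_ne_of_ne]
          · rintro rfl; exact heP hx
          · rintro rfl; exact hfP hx
        · rw [Equiv.swap_apply_of_ne_of_ne]
          · rintro rfl; exact hPQ.2.1 hx
          · rintro rfl; exact hf hx
      set h : (Fin m ≃ E) → ℝ := fun π => lateWeight k a π e * lateWeight k b π f * g π with hh
      have hsum : ∑ π, h π ≤ a * b * ∑ π, g π := by
        -- Symmetrize over exchanging `e` and `f`. The two terms add up to 2 if both are early, `2 *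
        -- (a * b)` if both are late, and `a + b = 2 * (a * b)` if they are separated.
        have h1 : 2 * ∑ π, h π = ∑ π, (h π + h (π.trans (Equiv.swap e f))) := by
          rw [Finset.sum_add_distrib, sum_comp_swap]; ring
        have h2 : ∑ π, (h π + h (π.trans (Equiv.swap e f))) ≤ ∑ π, 2 * (a * b) * g π := by
          refine Finset.sum_le_sum fun π _ => ?_
          simp only [hh, hgs, lateWeight_swap, Equiv.swap_apply_left, Equiv.swap_apply_right]
          rw [← add_mul]
          refine mul_le_mul_of_nonneg_right ?_ (hg0 π)
          unfold lateWeight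
          split_ifs <;> linarith
        rw [← Finset.mul_sum] at h2
        linarith
      have hPQ' := ih P hPQ.2.2
      calc _ = ∑ π, h π := by
            refine Finset.sum_congr rfl fun π _ => ?_
            rw [Finset.prod_insert heP, Finset.prod_insert hf]
            simp only [hh, hg]; ring
        _ ≤ a * b * ∑ π, g π := hsum
        _ ≤ a * b * (Fintype.card (Fin m ≃ E) * ((a * b) ^ Q.card * b ^ (Q.card - P.card))) :=
            mul_le_mul_of_nonneg_left hPQ' (by positivity)
        _ = _ := by
            rw [Finset.card_insert_of_notMem heP, Finset.card_insert_of_notMem hf,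
              Nat.add_sub_add_right]
            ring

end Averaging

/-! ### Support, true and false edges at a variable -/

/-- The edges from clauses in which the variable `y` supplies the only true literal. -/
def supportEdges (φ : Assignment n) (F : Formula n) (y : Fin n) : Finset (Edge F) :=
  Finset.univ.filter fun e => e.1.2 = y ∧ (y, φ y) ∈ e.1.1.1 ∧ target φ F e = true

/-- The edges from clauses in which `y` supplies a true literal, but not the only one. -/
def trueEdges (φ : Assignment n) (F : Formula n) (y : Fin n) : Finset (Edge F) :=
  Finset.univ.filter fun e => e.1.2 = y ∧ (y, φ y) ∈ e.1.1.1 ∧ target φ F e = false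

/-- The edges from clauses in which `y` supplies a false literal. -/
def falseEdges (φ : Assignment n) (F : Formula n) (y : Fin n) : Finset (Edge F) :=
  Finset.univ.filter fun e => e.1.2 = y ∧ (y, !φ y) ∈ e.1.1.1

theorem not_mem_and_mem_not (C : Clause n) (y : Fin n) (b : Bool) (h : (y, b) ∈ C.1)
    (h' : (y, !b) ∈ C.1) : False := by
  have := C.2.2 _ h _ h' rfl
  simp at this

theorem disjoint_supportEdges_trueEdges (φ : Assignment n) (F : Formula n) (y : Fin n) :
    Disjoint (supportEdges φ F y) (trueEdges φ F y) := by
  rw [Finset.disjoint_left]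
  intro e he he'
  simp only [supportEdges, trueEdges, Finset.mem_filter] at he he'
  simp [he.2.2.2] at he'

theorem disjoint_supportEdges_falseEdges (φ : Assignment n) (F : Formula n) (y : Fin n) :
    Disjoint (supportEdges φ F y) (falseEdges φ F y) := by
  rw [Finset.disjoint_left]
  intro e he he'
  simp only [supportEdges, falseEdges, Finset.mem_filter] at he he'
  exact not_mem_and_mem_not _ _ _ he.2.2.1 he'.2.2

theorem disjoint_trueEdges_falseEdges (φ : Assignment n) (F : Formula n) (y : Fin n) :
    Disjoint (trueEdges φ F y) (falseEdges φ F y) := by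
  rw [Finset.disjoint_left]
  intro e he he'
  simp only [trueEdges, falseEdges, Finset.mem_filter] at he he'
  exact not_mem_and_mem_not _ _ _ he.2.2.1 he'.2.2

/-- A satisfied clause in which `y` is false has a true literal elsewhere, so no justified warning
points away from `φ`. -/
theorem target_eq_false_of_mem_falseEdges {φ : Assignment n} (hF : F ⊆ satisfiedClauses φ)
    {y : Fin n} {e : Edge F} (he : e ∈ falseEdges φ F y) : target φ F e = false := by
  simp only [falseEdges, Finset.mem_filter, Finset.mem_univ, true_and] at he
  have := hF e.2.1
  simp only [satisfiedClauses, Finset.mem_filter, Finset.mem_univ, true_and] at this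
  obtain ⟨l, hl, hφ⟩ := this
  simp only [target, decide_eq_false_iff_not]
  intro h
  refine h l hl ?_ hφ
  rintro h'
  have h2 := e.1.1.2.2 _ hl _ he.2 (h'.trans he.1)
  rw [h2] at hφ
  simp at hφ

theorem margin_eq (φ : Assignment n) (α : Messages F) (y : Fin n) :
    margin φ α y = (∑ e ∈ supportEdges φ F y, if α e = true then 1 else 0) +
      (∑ e ∈ trueEdges φ F y, if α e = true then 1 else 0) -
      ∑ e ∈ falseEdges φ F y, if α e = true then 1 else 0 := by
  have h1 : received α F (y, φ y) = (∑ e ∈ supportEdges φ F y, if α e = true then 1 else 0) +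
      ∑ e ∈ trueEdges φ F y, if α e = true then 1 else 0 := by
    unfold received
    refine sum_eq_sum_add_sum _ (disjoint_supportEdges_trueEdges φ F y) fun e => ?_
    have he := e.2.1
    unfold supportEdges trueEdges
    rw [Finset.mem_filter, Finset.mem_filter, Finset.mem_filter, ← and_or_left, ← and_or_left,
      ← and_or_left]
    simp [he]
  have h2 : received α F (y, !φ y) = ∑ e ∈ falseEdges φ F y, if α e = true then 1 else 0 := by
    unfold received
    refine Finset.sum_congr ?_ fun _ _ => rfl
    ext e
    have he := e.2.1
    unfold falseEdges
    rw [Finset.mem_filter, Finset.mem_filter]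
    simp [he]
  unfold margin
  rw [h1, h2]

/-! ### Exponential moment of the margin -/

/-- The contribution of the edge `e` with message `v` to the exponential `exp (-s * margin)`. -/
noncomputable def edgeWeight (φ : Assignment n) (F : Formula n) (y : Fin n) (s : ℝ) (e : Edge F)
    (v : Bool) : ℝ :=
  if v = true then
    (if e ∈ supportEdges φ F y then Real.exp (-s) else 1) *
      (if e ∈ trueEdges φ F y then Real.exp (-s) else 1) *
      (if e ∈ falseEdges φ F y then Real.exp s else 1)
  else 1

theorem exp_neg_mul_margin (φ : Assignment n) (α : Messages F) (y : Fin n) (s : ℝ) :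
    Real.exp (-s * margin φ α y) = ∏ e, edgeWeight φ F y s e (α e) := by
  rw [margin_eq]
  exact (prod_ite_exp _ _ _ s α).symm

/-- An updated support edge has weight `exp (-s)`, below the fair-bit average, so its bound need not
depend on the order. Updated true and false edges carry 0 and have weight 1, which is why they enter
through `lateWeight`. -/
theorem edgeWeight_sum_le {φ : Assignment n} (hF : F ⊆ satisfiedClauses φ) (y : Fin n) {s : ℝ}
    (hs : 0 ≤ s) (k : ℕ) (π : EdgeOrder F) (e : Edge F) :
    ∑ v : Bool, edgeWeight φ F y s e (if e ∈ firstEdges π k then target φ F e else v) ≤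
      2 * ((if e ∈ supportEdges φ F y then (1 + Real.exp (-s)) / 2 else 1) *
        (if e ∈ trueEdges φ F y then lateWeight k ((1 + Real.exp (-s)) / 2) π e else 1) *
        (if e ∈ falseEdges φ F y then lateWeight k ((1 + Real.exp s) / 2) π e else 1)) := by
  have he : Real.exp (-s) ≤ 1 := Real.exp_le_one_iff.2 (by linarith)
  have hmem : e ∈ firstEdges π k ↔ (π.symm e : ℕ) < k := by simp [firstEdges]
  rw [Fintype.sum_bool]
  unfold edgeWeight lateWeight
  by_cases h1 : e ∈ supportEdges φ F y
  · have h2 := Finset.disjoint_left.1 (disjoint_supportEdges_trueEdges φ F y) h1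
    have h3 := Finset.disjoint_left.1 (disjoint_supportEdges_falseEdges φ F y) h1
    have ht : target φ F e = true := by
      simp only [supportEdges, Finset.mem_filter] at h1; exact h1.2.2.2
    simp only [h1, h2, h3, hmem, ht]
    by_cases hk : (π.symm e : ℕ) < k <;> simp [hk] <;> linarith
  by_cases h2 : e ∈ trueEdges φ F y
  · have h3 := Finset.disjoint_left.1 (disjoint_trueEdges_falseEdges φ F y) h2
    have ht : target φ F e = false := by
      simp only [trueEdges, Finset.mem_filter] at h2; exact h2.2.2.2
    simp only [h1, h2, h3, hmem, ht]
    by_cases hk : (π.symm e : ℕ) < k <;> simp [hk] <;> linarith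
  by_cases h3 : e ∈ falseEdges φ F y
  · have ht := target_eq_false_of_mem_falseEdges hF h3
    simp only [h1, h2, h3, hmem, ht]
    by_cases hk : (π.symm e : ℕ) < k <;> simp [hk] <;> linarith
  · simp only [h1, h2, h3]
    simp; norm_num

theorem sum_exp_neg_mul_margin_le {φ : Assignment n} (hF : F ⊆ satisfiedClauses φ) (y : Fin n)
    {s : ℝ} (hs : 0 ≤ s) (k : ℕ) (π : EdgeOrder F) :
    ∑ α : Messages F, Real.exp (-s * margin φ (hybrid φ (firstEdges π k) α) y) ≤
      Fintype.card (Messages F) * (((1 + Real.exp (-s)) / 2) ^ (supportEdges φ F y).card *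
        ((∏ e ∈ trueEdges φ F y, lateWeight k ((1 + Real.exp (-s)) / 2) π e) *
          ∏ e ∈ falseEdges φ F y, lateWeight k ((1 + Real.exp s) / 2) π e)) := by
  rw [Finset.sum_congr rfl fun α _ => exp_neg_mul_margin φ (hybrid φ (firstEdges π k) α) y s]
  refine (sum_prod_bool (fun e v => edgeWeight φ F y s e
    (if e ∈ firstEdges π k then target φ F e else v))).trans_le ?_
  refine (Finset.prod_le_prod (fun e _ => Finset.sum_nonneg fun v _ => ?_)
    (fun e _ => edgeWeight_sum_le hF y hs k π e)).trans (le_of_eq ?_)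
  · unfold edgeWeight; positivity
  · rw [prod_two_mul, prod_ite_mem_mul, Finset.prod_const, mul_assoc]

/-- The left side is `exp (s / 2) * cosh (s / 2)`, and `cosh x ≤ exp (x ^ 2 / 2)`. -/
theorem one_add_exp_div_two_le (s : ℝ) : (1 + Real.exp s) / 2 ≤ Real.exp (s / 2 + s ^ 2 / 8) := by
  have h : (1 + Real.exp s) / 2 = Real.exp (s / 2) * Real.cosh (s / 2) := by
    rw [Real.cosh_eq, mul_div_assoc', mul_add, ← Real.exp_add, ← Real.exp_add]
    simp [add_comm]
  rw [h, Real.exp_add]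
  refine mul_le_mul_of_nonneg_left ((Real.cosh_le_exp_half_sq _).trans ?_) (Real.exp_pos _).le
  apply Real.exp_le_exp.2
  linarith

theorem sum_sum_exp_neg_mul_margin_le {φ : Assignment n} (hF : F ⊆ satisfiedClauses φ)
    (y : Fin n) {s : ℝ} (hs : 0 ≤ s) (k : ℕ) :
    ∑ π : EdgeOrder F, ∑ α : Messages F,
        Real.exp (-s * margin φ (hybrid φ (firstEdges π k) α) y) ≤
      Fintype.card (EdgeOrder F) * (Fintype.card (Messages F) * Real.exp (
        (supportEdges φ F y).card * (-s / 2 + s ^ 2 / 8) + (falseEdges φ F y).card * (s ^ 2 / 4) +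
        ((falseEdges φ F y).card - (trueEdges φ F y).card : ℕ) * (s / 2 + s ^ 2 / 8))) := by
  set a := (1 + Real.exp (-s)) / 2 with ha
  set b := (1 + Real.exp s) / 2 with hb
  have e1 : Real.exp (-s) * Real.exp s = 1 := by rw [← Real.exp_add]; simp
  have ha0 : 0 ≤ a := by positivity
  have ha1 : a ≤ 1 := by
    have : Real.exp (-s) ≤ 1 := Real.exp_le_one_iff.2 (by linarith)
    linarith
  have hb1 : 1 ≤ b := by
    have := Real.one_le_exp hs
    linarith
  -- This is where `exp (-s) * exp s = 1` makes the pairing lossless for separated edges.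
  have hab : a + b = 2 * (a * b) := by
    have : 2 * (a * b) = (1 + Real.exp (-s) + Real.exp s + Real.exp (-s) * Real.exp s) / 2 := by
      rw [ha, hb]; ring
    rw [this, e1, ha, hb]; ring
  have hab1 : 1 ≤ a * b := by nlinarith [sq_nonneg (a - b), mul_nonneg ha0 (zero_le_one.trans hb1)]
  have hae : a ≤ Real.exp (-s / 2 + s ^ 2 / 8) := by
    have := one_add_exp_div_two_le (-s)
    rwa [neg_sq] at this
  have hbe : b ≤ Real.exp (s / 2 + s ^ 2 / 8) := one_add_exp_div_two_le s
  -- The linear terms cancel within a pair.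
  have habe : a * b ≤ Real.exp (s ^ 2 / 4) := by
    refine (mul_le_mul hae hbe (by positivity) (Real.exp_pos _).le).trans (le_of_eq ?_)
    rw [← Real.exp_add]; congr 1; ring
  calc _ ≤ ∑ π : EdgeOrder F, Fintype.card (Messages F) * (a ^ (supportEdges φ F y).card *
        ((∏ e ∈ trueEdges φ F y, lateWeight k a π e) *
          ∏ e ∈ falseEdges φ F y, lateWeight k b π e)) :=
        Finset.sum_le_sum fun π _ => sum_exp_neg_mul_margin_le hF y hs k π
    _ = Fintype.card (Messages F) * (a ^ (supportEdges φ F y).card * ∑ π : EdgeOrder F,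
        ((∏ e ∈ trueEdges φ F y, lateWeight k a π e) *
          ∏ e ∈ falseEdges φ F y, lateWeight k b π e)) := by
        rw [Finset.mul_sum, Finset.mul_sum]
    _ ≤ Fintype.card (Messages F) * (a ^ (supportEdges φ F y).card *
        (Fintype.card (EdgeOrder F) * ((a * b) ^ (falseEdges φ F y).card *
          b ^ ((falseEdges φ F y).card - (trueEdges φ F y).card)))) := by
        gcongr
        exact sum_prod_lateWeight_le k ha0 ha1 hb1 hab hab1 _ _
          (disjoint_trueEdges_falseEdges φ F y)
    _ = Fintype.card (EdgeOrder F) * (Fintype.card (Messages F) *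
        (a ^ (supportEdges φ F y).card * (a * b) ^ (falseEdges φ F y).card *
          b ^ ((falseEdges φ F y).card - (trueEdges φ F y).card))) := by ring
    _ ≤ _ := by
        rw [Real.exp_add, Real.exp_add, Real.exp_nat_mul, Real.exp_nat_mul, Real.exp_nat_mul]
        gcongr

/-! ### Counting the possible clauses of each kind -/

/-- The clauses in which `y` supplies the only true literal. -/
def supportClauses (φ : Assignment n) (y : Fin n) : Finset (Clause n) :=
  Finset.univ.filter fun C => (y, φ y) ∈ C.1 ∧ ∀ l ∈ C.1, l.1 ≠ y → φ l.1 ≠ l.2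

/-- The clauses in which `y` and some other variable supply true literals. -/
def trueClauses (φ : Assignment n) (y : Fin n) : Finset (Clause n) :=
  Finset.univ.filter fun C => (y, φ y) ∈ C.1 ∧ ¬∀ l ∈ C.1, l.1 ≠ y → φ l.1 ≠ l.2

/-- The clauses in which `y` supplies a false literal and some other variable a true one. -/
def falseClauses (φ : Assignment n) (y : Fin n) : Finset (Clause n) :=
  Finset.univ.filter fun C => (y, !φ y) ∈ C.1 ∧ ¬∀ l ∈ C.1, l.1 ≠ y → φ l.1 ≠ l.2

theorem card_edges_eq {F : Formula n} {y : Fin n} {s : Finset (Edge F)} {A : Finset (Clause n)}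
    (hs : ∀ e : Edge F, e ∈ s ↔ e.1.2 = y ∧ e.1.1 ∈ A)
    (hA : ∀ C ∈ A, y ∈ C.1.image Prod.fst) : s.card = (F ∩ A).card := by
  refine Finset.card_bij (fun e _ => e.1.1) ?_ ?_ ?_
  · intro e he
    exact Finset.mem_inter.2 ⟨e.2.1, ((hs e).1 he).2⟩
  · intro e he e' he' h
    exact Subtype.ext (Prod.ext h (((hs e).1 he).1.trans ((hs e').1 he').1.symm))
  · intro C hC
    rw [Finset.mem_inter] at hC
    exact ⟨⟨(C, y), hC.1, hA C hC.2⟩, (hs _).2 ⟨rfl, hC.2⟩, rfl⟩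

theorem card_supportEdges (φ : Assignment n) (F : Formula n) (y : Fin n) :
    (supportEdges φ F y).card = (F ∩ supportClauses φ y).card := by
  refine card_edges_eq (y := y) (fun e => ?_) fun C hC => ?_
  · unfold supportEdges supportClauses target
    rw [Finset.mem_filter, Finset.mem_filter, decide_eq_true_iff]
    simp only [Finset.mem_univ, true_and]
    refine and_congr_right fun h => ?_
    rw [h]
  · unfold supportClauses at hC
    exact Finset.mem_image.2 ⟨_, (Finset.mem_filter.1 hC).2.1, rfl⟩

theorem card_trueEdges (φ : Assignment n) (F : Formula n) (y : Fin n) :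
    (trueEdges φ F y).card = (F ∩ trueClauses φ y).card := by
  refine card_edges_eq (y := y) (fun e => ?_) fun C hC => ?_
  · unfold trueEdges trueClauses target
    rw [Finset.mem_filter, Finset.mem_filter, decide_eq_false_iff_not]
    simp only [Finset.mem_univ, true_and]
    refine and_congr_right fun h => ?_
    rw [h]
  · unfold trueClauses at hC
    exact Finset.mem_image.2 ⟨_, (Finset.mem_filter.1 hC).2.1, rfl⟩

theorem card_falseEdges {φ : Assignment n} {F : Formula n} (hF : F ⊆ satisfiedClauses φ)
    (y : Fin n) : (falseEdges φ F y).card = (F ∩ falseClauses φ y).card := by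
  refine card_edges_eq (y := y) (fun e => ?_) fun C hC => ?_
  · constructor
    · intro he
      have ht := target_eq_false_of_mem_falseEdges hF he
      unfold falseEdges at he
      unfold target at ht
      unfold falseClauses
      rw [Finset.mem_filter] at he ⊢
      rw [decide_eq_false_iff_not, he.2.1] at ht
      exact ⟨he.2.1, Finset.mem_univ _, he.2.2, ht⟩
    · intro he
      unfold falseClauses at he
      unfold falseEdges
      rw [Finset.mem_filter] at he ⊢
      exact ⟨Finset.mem_univ _, he.1, he.2.2.1⟩
  · unfold falseClauses at hC
    exact Finset.mem_image.2 ⟨_, (Finset.mem_filter.1 hC).2.1, rfl⟩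

theorem supportClauses_subset (φ : Assignment n) (y : Fin n) :
    supportClauses φ y ⊆ satisfiedClauses φ := by
  intro C hC
  unfold supportClauses at hC
  unfold satisfiedClauses
  rw [Finset.mem_filter] at hC ⊢
  exact ⟨hC.1, _, hC.2.1, rfl⟩

theorem trueClauses_subset (φ : Assignment n) (y : Fin n) :
    trueClauses φ y ⊆ satisfiedClauses φ := by
  intro C hC
  unfold trueClauses at hC
  unfold satisfiedClauses
  rw [Finset.mem_filter] at hC ⊢
  exact ⟨hC.1, _, hC.2.1, rfl⟩

theorem falseClauses_subset (φ : Assignment n) (y : Fin n) :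
    falseClauses φ y ⊆ satisfiedClauses φ := by
  intro C hC
  unfold falseClauses at hC
  unfold satisfiedClauses
  rw [Finset.mem_filter] at hC ⊢
  obtain ⟨h1, h2, h3⟩ := hC
  push Not at h3
  obtain ⟨l, hl, -, h⟩ := h3
  exact ⟨h1, l, hl, h⟩

theorem disjoint_trueClauses_falseClauses (φ : Assignment n) (y : Fin n) :
    Disjoint (trueClauses φ y) (falseClauses φ y) := by
  rw [Finset.disjoint_left]
  intro C h h'
  unfold trueClauses at h
  unfold falseClauses at h'
  rw [Finset.mem_filter] at h h'
  exact not_mem_and_mem_not C y _ h.2.1 h'.2.1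

/-- Negate the literal if its variable is `y`. -/
def flipLiteral (y : Fin n) (l : Literal n) : Literal n := if l.1 = y then (l.1, !l.2) else l

theorem flipLiteral_involutive (y : Fin n) : Function.Involutive (flipLiteral y) := by
  intro l
  unfold flipLiteral
  split_ifs with h
  · simp
  · rfl

theorem flipLiteral_fst (y : Fin n) (l : Literal n) : (flipLiteral y l).1 = l.1 := by
  unfold flipLiteral; split_ifs <;> rfl

theorem flipLiteral_of_ne {y : Fin n} {l : Literal n} (h : l.1 ≠ y) : flipLiteral y l = l :=
  if_neg h

/-- Negate the literal with the variable `y`, if the clause contains one. -/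
def flipClause (y : Fin n) (C : Clause n) : Clause n :=
  ⟨C.1.map ⟨flipLiteral y, (flipLiteral_involutive y).injective⟩, by
    rw [Finset.card_map]; exact C.2.1, by
    intro l hl l' hl' h
    obtain ⟨a, ha, rfl⟩ := Finset.mem_map.1 hl
    obtain ⟨b, hb, rfl⟩ := Finset.mem_map.1 hl'
    simp only [Function.Embedding.coeFn_mk, flipLiteral_fst] at h ⊢
    rw [C.2.2 a ha b hb h]⟩

theorem mem_flipClause {y : Fin n} {C : Clause n} {l : Literal n} :
    l ∈ (flipClause y C).1 ↔ flipLiteral y l ∈ C.1 := by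
  unfold flipClause
  rw [Finset.mem_map]
  constructor
  · rintro ⟨a, ha, rfl⟩
    rwa [Function.Embedding.coeFn_mk, flipLiteral_involutive]
  · intro h
    exact ⟨_, h, flipLiteral_involutive y l⟩

theorem flipClause_flipClause (y : Fin n) (C : Clause n) : flipClause y (flipClause y C) = C := by
  apply Subtype.ext
  ext l
  rw [mem_flipClause, mem_flipClause, flipLiteral_involutive]

theorem forall_mem_flipClause (φ : Assignment n) (y : Fin n) (C : Clause n) :
    (∀ l ∈ (flipClause y C).1, l.1 ≠ y → φ l.1 ≠ l.2) ↔ ∀ l ∈ C.1, l.1 ≠ y → φ l.1 ≠ l.2 := by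
  refine forall_congr' fun l => ?_
  rw [mem_flipClause]
  by_cases h : l.1 = y
  · simp [h]
  · rw [flipLiteral_of_ne h]

/-- Negating the literal of `y` exchanges the two kinds, since the condition on the other literals
is unaffected. -/
theorem card_trueClauses (φ : Assignment n) (y : Fin n) :
    (trueClauses φ y).card = (falseClauses φ y).card := by
  refine Finset.card_nbij' (flipClause y) (flipClause y) ?_ ?_
    (fun C _ => flipClause_flipClause y C) fun C _ => flipClause_flipClause y C
  · intro C hC
    unfold trueClauses at hC
    unfold falseClauses
    rw [Finset.mem_coe, Finset.mem_filter] at hC ⊢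
    rw [mem_flipClause, forall_mem_flipClause]
    simpa [flipLiteral] using hC
  · intro C hC
    unfold falseClauses at hC
    unfold trueClauses
    rw [Finset.mem_coe, Finset.mem_filter] at hC ⊢
    rw [mem_flipClause, forall_mem_flipClause]
    simpa [flipLiteral] using hC

theorem card_falseClauses_le (φ : Assignment n) (y : Fin n) :
    ((falseClauses φ y).card : ℝ) ≤ 2 * (n : ℝ) ^ 2 := by
  have h : (falseClauses φ y).card ≤
      ((Finset.univ : Finset (Literal n)).powersetCard 2).card := by
    refine Finset.card_le_card_of_injOn (fun C => C.1.erase (y, !φ y)) ?_ ?_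
    · intro C hC
      unfold falseClauses at hC
      rw [Finset.mem_coe, Finset.mem_filter] at hC
      rw [Finset.mem_coe, Finset.mem_powersetCard]
      exact ⟨Finset.subset_univ _, by rw [Finset.card_erase_of_mem hC.2.1, C.2.1]⟩
    · intro C hC D hD h
      unfold falseClauses at hC hD
      rw [Finset.mem_coe, Finset.mem_filter] at hC hD
      apply Subtype.ext
      rw [← Finset.insert_erase hC.2.1, ← Finset.insert_erase hD.2.1]
      exact congrArg _ h
  rw [Finset.card_powersetCard, Finset.card_univ, Fintype.card_prod, Fintype.card_fin,
    Fintype.card_bool] at h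
  have h2 : (((n * 2).choose 2 : ℕ) : ℝ) ≤ 2 * (n : ℝ) ^ 2 := by
    rw [Nat.cast_choose_two]
    push_cast
    nlinarith [Nat.cast_nonneg (α := ℝ) n]
  exact (Nat.cast_le.2 h).trans h2

/-- The clause in which the variables `y ∉ s` supply the only true literal. -/
def supportClause (φ : Assignment n) (y : Fin n) (s : Finset (Fin n)) (hs : s.card = 2)
    (hy : y ∉ s) : Clause n :=
  ⟨insert (y, φ y) (s.image fun z => (z, !φ z)), by
    rw [Finset.card_insert_of_notMem, Finset.card_image_of_injective, hs]
    · intro a b h; exact (Prod.ext_iff.1 h).1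
    · intro h
      obtain ⟨z, hz, h⟩ := Finset.mem_image.1 h
      have hzy : z = y := (Prod.ext_iff.1 h).1
      exact hy (hzy ▸ hz), by
    intro l hl l' hl' h
    rw [Finset.mem_insert, Finset.mem_image] at hl hl'
    rcases hl with rfl | ⟨z, hz, rfl⟩
    · rcases hl' with rfl | ⟨z', hz', rfl⟩
      · rfl
      · have hzy : y = z' := h
        exact absurd (hzy ▸ hz') hy
    · rcases hl' with rfl | ⟨z', hz', rfl⟩
      · have hzy : z = y := h
        exact absurd (hzy ▸ hz) hy
      · have hzz : z = z' := h
        rw [hzz]⟩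

theorem le_card_supportClauses (hn : 6 ≤ n) (φ : Assignment n) (y : Fin n) :
    (n : ℝ) ^ 2 / 4 ≤ (supportClauses φ y).card := by
  have h : ((Finset.univ.erase y).powersetCard 2).card ≤ (supportClauses φ y).card := by
    refine Finset.card_le_card_of_surjOn (fun C => (C.1.image Prod.fst).erase y) ?_
    intro s hs
    rw [Finset.mem_coe, Finset.mem_powersetCard] at hs
    have hy : y ∉ s := fun h => Finset.notMem_erase y _ (hs.1 h)
    refine ⟨supportClause φ y s hs.2 hy, ?_, ?_⟩
    · unfold supportClauses supportClause
      rw [Finset.mem_coe, Finset.mem_filter]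
      refine ⟨Finset.mem_univ _, Finset.mem_insert_self _ _, fun l hl hly => ?_⟩
      rw [Finset.mem_insert, Finset.mem_image] at hl
      rcases hl with rfl | ⟨z, -, rfl⟩
      · exact absurd rfl hly
      · simp
    · simp only [supportClause, Finset.image_insert, Finset.image_image]
      rw [Finset.erase_insert]
      · ext z; simp
      · simpa using hy
  rw [Finset.card_powersetCard, Finset.card_erase_of_mem (Finset.mem_univ _), Finset.card_univ,
    Fintype.card_fin] at h
  -- Equivalent to `n ^ 2 - 6 * n + 4 ≥ 0`, whence `6 ≤ n`.
  have h2 : (n : ℝ) ^ 2 / 4 ≤ ((n - 1).choose 2 : ℕ) := by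
    rw [Nat.cast_choose_two, Nat.cast_sub (by omega)]
    have : (6 : ℝ) ≤ n := by exact_mod_cast hn
    push_cast
    nlinarith
  exact h2.trans (Nat.cast_le.2 h)

/-! ### Chernoff bounds for the planted formula -/

theorem sum_powerset_weight_mul_exp {ι : Type*} [DecidableEq ι] (S : Finset ι) (t : ι → ℝ)
    (p : ℝ) :
    ∑ F ∈ S.powerset, p ^ F.card * (1 - p) ^ (S.card - F.card) * Real.exp (∑ C ∈ F, t C) =
      ∏ C ∈ S, (p * Real.exp (t C) + (1 - p)) := by
  rw [Finset.prod_add]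
  refine Finset.sum_congr rfl fun F hF => ?_
  rw [Finset.prod_mul_distrib, Finset.prod_const, Finset.prod_const, Real.exp_sum,
    Finset.card_sdiff_of_subset (Finset.mem_powerset.1 hF)]
  ring

theorem prod_le_exp_sum {ι : Type*} (S : Finset ι) (t : ι → ℝ) {p : ℝ} (hp : 0 ≤ p)
    (hp1 : p ≤ 1) :
    ∏ C ∈ S, (p * Real.exp (t C) + (1 - p)) ≤ Real.exp (p * ∑ C ∈ S, (Real.exp (t C) - 1)) := by
  rw [Finset.mul_sum, Real.exp_sum]
  refine Finset.prod_le_prod (fun C _ => ?_) fun C _ => ?_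
  · have := Real.exp_pos (t C)
    have : 0 ≤ 1 - p := by linarith
    positivity
  · have := Real.add_one_le_exp (p * (Real.exp (t C) - 1))
    linarith

/-- Exponential Markov inequality for a sum of clause weights. Formulas not satisfied by `φ` have
probability zero, so `T` is constrained only on the others. -/
theorem toOuterMeasure_plantedFormula_le (p : unitInterval) (φ : Assignment n)
    (T : Set (Formula n)) (t : Clause n → ℝ) (x : ℝ)
    (hT : ∀ F ∈ T, F ⊆ satisfiedClauses φ → x ≤ ∑ C ∈ F, t C) :
    (plantedFormula p φ).toOuterMeasure T ≤ ENNReal.ofReal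
      (Real.exp ((p : ℝ) * ∑ C ∈ satisfiedClauses φ, (Real.exp (t C) - 1) - x)) := by
  classical
  have hp0 := p.2.1
  have hp1 : 0 ≤ 1 - (p : ℝ) := sub_nonneg.2 p.2.2
  set S := satisfiedClauses φ with hS
  have hw : ∀ F : Formula n, F ⊆ S → plantedWeight p φ F =
      ENNReal.ofReal ((p : ℝ) ^ F.card * (1 - (p : ℝ)) ^ (S.card - F.card)) := by
    intro F hF
    unfold plantedWeight
    rw [if_pos hF, ENNReal.ofReal_mul (by positivity), ENNReal.ofReal_pow hp0,
      ENNReal.ofReal_pow hp1]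
  rw [PMF.toOuterMeasure_apply_fintype]
  calc _ ≤ ∑ F ∈ S.powerset, ENNReal.ofReal ((p : ℝ) ^ F.card *
        (1 - (p : ℝ)) ^ (S.card - F.card) * Real.exp (∑ C ∈ F, t C) * Real.exp (-x)) := by
        rw [← Finset.sum_subset (Finset.subset_univ S.powerset)]
        · refine Finset.sum_le_sum fun F hF => ?_
          rw [Finset.mem_powerset] at hF
          by_cases hFT : F ∈ T
          · rw [Set.indicator_of_mem hFT]
            change plantedWeight p φ F ≤ _
            rw [hw F hF]
            apply ENNReal.ofReal_le_ofReal
            rw [mul_assoc _ (Real.exp _) (Real.exp _), ← Real.exp_add]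
            refine le_mul_of_one_le_right (by positivity) (Real.one_le_exp ?_)
            have := hT F hFT hF
            linarith
          · rw [Set.indicator_of_notMem hFT]; exact zero_le
        · intro F _ hF
          rw [Finset.mem_powerset] at hF
          by_cases hFT : F ∈ T
          · rw [Set.indicator_of_mem hFT]
            change plantedWeight p φ F = 0
            unfold plantedWeight
            rw [if_neg hF]
          · rw [Set.indicator_of_notMem hFT]
    _ = ENNReal.ofReal (∑ F ∈ S.powerset, (p : ℝ) ^ F.card *
        (1 - (p : ℝ)) ^ (S.card - F.card) * Real.exp (∑ C ∈ F, t C) * Real.exp (-x)) := by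
        rw [ENNReal.ofReal_sum_of_nonneg]
        intros; positivity
    _ ≤ _ := by
        apply ENNReal.ofReal_le_ofReal
        rw [← Finset.sum_mul, sum_powerset_weight_mul_exp, sub_eq_add_neg (_ * _),
          Real.exp_add]
        exact mul_le_mul_of_nonneg_right (prod_le_exp_sum S t hp0 p.2.2) (Real.exp_pos _).le

theorem toOuterMeasure_plantedFormula_le_of_card (p : unitInterval) (φ : Assignment n)
    {A B : Finset (Clause n)} (hA : A ⊆ satisfiedClauses φ) (hB : B ⊆ satisfiedClauses φ)
    (hAB : Disjoint A B) {a b : ℝ} (ha : |a| ≤ 1) (hb : |b| ≤ 1) (T : Set (Formula n)) (x : ℝ)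
    (hT : ∀ F ∈ T, F ⊆ satisfiedClauses φ → x ≤ a * (F ∩ A).card + b * (F ∩ B).card) :
    (plantedFormula p φ).toOuterMeasure T ≤ ENNReal.ofReal
      (Real.exp ((p : ℝ) * (A.card * (a + a ^ 2) + B.card * (b + b ^ 2)) - x)) := by
  classical
  have hexp : ∀ {c : ℝ}, |c| ≤ 1 → Real.exp c - 1 ≤ c + c ^ 2 := fun {c} hc => by
    have := (abs_le.1 (Real.abs_exp_sub_one_sub_id_le hc)).2
    linarith
  refine (toOuterMeasure_plantedFormula_le p φ T
    (fun C => (if C ∈ A then a else 0) + if C ∈ B then b else 0) x fun F hF hFS => ?_).trans ?_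
  · refine (hT F hF hFS).trans_eq ?_
    rw [Finset.sum_add_distrib, Finset.sum_ite_mem, Finset.sum_ite_mem, Finset.sum_const,
      Finset.sum_const, nsmul_eq_mul, nsmul_eq_mul, mul_comm a, mul_comm b]
  · apply ENNReal.ofReal_le_ofReal
    apply Real.exp_le_exp.2
    refine sub_le_sub_right (mul_le_mul_of_nonneg_left ?_ p.2.1) x
    calc _ ≤ ∑ C ∈ satisfiedClauses φ, ((if C ∈ A then a + a ^ 2 else 0) +
          if C ∈ B then b + b ^ 2 else 0) := by
          refine Finset.sum_le_sum fun C _ => ?_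
          by_cases h1 : C ∈ A
          · have h2 := Finset.disjoint_left.1 hAB h1
            simpa [h1, h2] using hexp ha
          · by_cases h2 : C ∈ B
            · simpa [h1, h2] using hexp hb
            · simp [h1, h2]
      _ = _ := by
          rw [Finset.sum_add_distrib, Finset.sum_ite_mem, Finset.sum_ite_mem, Finset.sum_const,
            Finset.sum_const, nsmul_eq_mul, nsmul_eq_mul, Finset.inter_eq_right.2 hA,
            Finset.inter_eq_right.2 hB]

/-- The formula `F` is satisfied by `φ`, and the numbers of clauses of each kind at every variable
are close to their expectations; `q` stands for `p * n ^ 2`. -/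
structure Typical (q : ℝ) (φ : Assignment n) (F : Formula n) : Prop where
  subset : F ⊆ satisfiedClauses φ
  support : ∀ y, q / 8 ≤ (F ∩ supportClauses φ y).card
  falseClauses_le : ∀ y, ((F ∩ falseClauses φ y).card : ℝ) ≤ 4 * q
  falseClauses_le_add :
    ∀ y, ((F ∩ falseClauses φ y).card : ℝ) ≤ (F ∩ trueClauses φ y).card + q / 100

theorem toOuterMeasure_not_typical_le (hn : 6 ≤ n) (p : unitInterval) (φ : Assignment n) :
    (plantedFormula p φ).toOuterMeasure {F | ¬Typical ((p : ℝ) * (n : ℝ) ^ 2) φ F} ≤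
      (1 + n * 3) * ENNReal.ofReal (Real.exp (-((p : ℝ) * (n : ℝ) ^ 2 / 1000000))) := by
  set q := (p : ℝ) * (n : ℝ) ^ 2 with hq
  have hp := p.2.1
  have hq0 : 0 ≤ q := by positivity
  set ε := ENNReal.ofReal (Real.exp (-(q / 1000000))) with hε
  have hM : ∀ y, (p : ℝ) * (falseClauses φ y).card ≤ 2 * q := fun y => by
    have := mul_le_mul_of_nonneg_left (card_falseClauses_le φ y) hp
    rw [hq]; linarith
  set μ := (plantedFormula p φ).toOuterMeasure with hμ
  -- A null event: the condition on `T` is vacuous, so any threshold serves, and this one gives `ε`.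
  have h0 : μ {F | ¬F ⊆ satisfiedClauses φ} ≤ ε := by
    refine (toOuterMeasure_plantedFormula_le_of_card p φ (Finset.empty_subset _)
      (Finset.empty_subset _) (Finset.disjoint_empty_left _) (a := 0) (b := 0) (by simp)
      (by simp) _ (q / 1000000) fun F h h' => absurd h' h).trans ?_
    apply ENNReal.ofReal_le_ofReal
    simp
  have h1 : ∀ y, μ {F | ¬q / 8 ≤ (F ∩ supportClauses φ y).card} ≤ ε := fun y => by
    refine (toOuterMeasure_plantedFormula_le_of_card p φ (supportClauses_subset φ y)
      (Finset.empty_subset _) (Finset.disjoint_empty_right _) (a := -(1 / 4)) (b := 0)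
      (by norm_num [abs_le]) (by simp) _ (-(q / 32)) fun F h _ => ?_).trans ?_
    · simp only [Set.mem_ofPred_eq, not_le] at h
      simp only [zero_mul, add_zero]
      linarith
    · apply ENNReal.ofReal_le_ofReal
      apply Real.exp_le_exp.2
      have := mul_le_mul_of_nonneg_left (le_card_supportClauses hn φ y) hp
      simp only [Finset.card_empty, Nat.cast_zero, zero_mul, add_zero]
      nlinarith
  have h2 : ∀ y, μ {F | ¬((F ∩ falseClauses φ y).card : ℝ) ≤ 4 * q} ≤ ε := fun y => by
    refine (toOuterMeasure_plantedFormula_le_of_card p φ (falseClauses_subset φ y)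
      (Finset.empty_subset _) (Finset.disjoint_empty_right _) (a := 1 / 2) (b := 0)
      (by norm_num [abs_le]) (by simp) _ (2 * q) fun F h _ => ?_).trans ?_
    · simp only [Set.mem_ofPred_eq, not_le] at h
      simp only [zero_mul, add_zero]
      linarith
    · apply ENNReal.ofReal_le_ofReal
      apply Real.exp_le_exp.2
      simp only [Finset.card_empty, Nat.cast_zero, zero_mul, add_zero]
      nlinarith [hM y]
  -- Equal class sizes cancel the linear terms. The quadratic ones add up to at most `4 * q / 10 ^
  -- 6`, below the threshold `q / 10 ^ 5`.
  have h3 : ∀ y, μ {F | ¬((F ∩ falseClauses φ y).card : ℝ) ≤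
      (F ∩ trueClauses φ y).card + q / 100} ≤ ε := fun y => by
    refine (toOuterMeasure_plantedFormula_le_of_card p φ (trueClauses_subset φ y)
      (falseClauses_subset φ y) (disjoint_trueClauses_falseClauses φ y) (a := -(1 / 1000))
      (b := 1 / 1000) (by norm_num [abs_le]) (by norm_num [abs_le]) _ (q / 100000)
      fun F h _ => ?_).trans ?_
    · simp only [Set.mem_ofPred_eq, not_le] at h
      linarith
    · apply ENNReal.ofReal_le_ofReal
      apply Real.exp_le_exp.2
      rw [card_trueClauses]
      nlinarith [hM y]
  have hsub : {F | ¬Typical q φ F} ⊆ {F | ¬F ⊆ satisfiedClauses φ} ∪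
      ⋃ y, ({F | ¬q / 8 ≤ (F ∩ supportClauses φ y).card} ∪
        ({F | ¬((F ∩ falseClauses φ y).card : ℝ) ≤ 4 * q} ∪
          {F | ¬((F ∩ falseClauses φ y).card : ℝ) ≤ (F ∩ trueClauses φ y).card + q / 100})) := by
    intro F hF
    by_contra h
    simp only [Set.mem_union, Set.mem_iUnion, Set.mem_ofPred_eq, not_or, not_exists, not_not] at h
    exact hF ⟨h.1, fun y => (h.2 y).1, fun y => (h.2 y).2.1, fun y => (h.2 y).2.2⟩
  refine (MeasureTheory.measure_mono hsub).trans ((MeasureTheory.measure_union_le _ _).trans ?_)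
  rw [add_mul, one_mul]
  refine add_le_add h0 ((MeasureTheory.measure_iUnion_fintype_le μ _).trans ?_)
  refine (Finset.sum_le_card_nsmul _ _ (3 * ε) fun y _ => ?_).trans ?_
  · refine (MeasureTheory.measure_union_le _ _).trans ((add_le_add (h1 y)
      ((MeasureTheory.measure_union_le _ _).trans (add_le_add (h2 y) (h3 y)))).trans_eq ?_)
    ring
  · rw [Finset.card_univ, Fintype.card_fin, nsmul_eq_mul, mul_assoc]

/-! ### Probability tools and the union bound -/

theorem toOuterMeasure_le_one {α : Type*} (p : PMF α) (s : Set α) : p.toOuterMeasure s ≤ 1 :=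
  (MeasureTheory.measure_mono (Set.subset_univ s)).trans_eq
    ((PMF.toOuterMeasure_apply_eq_one_iff p _).2 (Set.subset_univ _))

theorem one_sub_le_toOuterMeasure {α : Type*} (p : PMF α) (s : Set α) :
    1 - p.toOuterMeasure sᶜ ≤ p.toOuterMeasure s := by
  rw [tsub_le_iff_right]
  refine le_trans (le_of_eq ?_) (MeasureTheory.measure_union_le s sᶜ)
  rw [Set.union_compl_self]
  exact ((PMF.toOuterMeasure_apply_eq_one_iff p _).2 (Set.subset_univ _)).symm

theorem toOuterMeasure_bind_le {α β : Type*} (p : PMF α) (f : α → PMF β) (s : Set β)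
    (G : α → Prop) (ε : ENNReal) (h : ∀ a, G a → (f a).toOuterMeasure s ≤ ε) :
    (p.bind f).toOuterMeasure s ≤ p.toOuterMeasure {a | ¬G a} + ε := by
  classical
  rw [PMF.toOuterMeasure_bind_apply, PMF.toOuterMeasure_apply]
  calc _ ≤ ∑' a, ({a | ¬G a}.indicator p a + p a * ε) := by
        refine ENNReal.tsum_le_tsum fun a => ?_
        by_cases ha : G a
        · exact le_add_left (mul_le_mul_right (h a ha) _)
        · refine le_add_right ?_
          rw [Set.indicator_of_mem (by exact ha)]
          exact mul_le_of_le_one_right' (toOuterMeasure_le_one _ s)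
    _ = _ := by rw [ENNReal.tsum_add, ENNReal.tsum_mul_right, p.tsum_coe, one_mul]

section UnionBound

variable {Ω Ω' Y : Type*}

open Classical in
/-- The indicator function of the complement of an event. -/
noncomputable def badIndicator (P : Ω → Ω' → Prop) (π : Ω) (α : Ω') : ℝ :=
  if P π α then 0 else 1

theorem badIndicator_nonneg (P : Ω → Ω' → Prop) (π : Ω) (α : Ω') : 0 ≤ badIndicator P π α := by
  unfold badIndicator; positivity

variable [Fintype Ω] [Fintype Ω'] [Fintype Y]

theorem sum_badIndicator_le (P : Ω → Ω' → Prop) (X : ℕ → Y → Ω → Ω' → ℤ) (N : ℕ) {s M : ℝ}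
    (hs : 0 ≤ s) (hP : ∀ π α, ¬P π α → ∃ k ≤ N, ∃ y, X k y π α ≤ 1)
    (hX : ∀ k y, ∑ π, ∑ α, Real.exp (-s * X k y π α) ≤ M) :
    ∑ π, ∑ α, badIndicator P π α ≤ (N + 1) * Fintype.card Y * Real.exp s * M := by
  have key : ∀ π α, badIndicator P π α ≤
      ∑ k ∈ Finset.range (N + 1), ∑ y, Real.exp s * Real.exp (-s * X k y π α) := by
    intro π α
    unfold badIndicator
    split_ifs with hf
    · positivity
    · obtain ⟨k, hk, y, hy⟩ := hP π α hf
      have hy' : (X k y π α : ℝ) ≤ 1 := by exact_mod_cast hy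
      -- Margins are integers, so failing to reach 2 means being at most 1; hence the factor `exp
      -- s`.
      have h1 : 1 ≤ Real.exp s * Real.exp (-s * X k y π α) := by
        rw [← Real.exp_add]
        apply Real.one_le_exp
        nlinarith
      refine h1.trans ((Finset.single_le_sum (f := fun y => Real.exp s *
        Real.exp (-s * X k y π α)) (fun _ _ => by positivity) (Finset.mem_univ y)).trans ?_)
      exact Finset.single_le_sum (f := fun k => ∑ y, Real.exp s * Real.exp (-s * X k y π α))
        (fun _ _ => by positivity) (Finset.mem_range.2 (by omega))
  calc _ ≤ ∑ π, ∑ α, ∑ k ∈ Finset.range (N + 1), ∑ y,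
        Real.exp s * Real.exp (-s * X k y π α) :=
        Finset.sum_le_sum fun π _ => Finset.sum_le_sum fun α _ => key π α
    _ = ∑ k ∈ Finset.range (N + 1), ∑ y, Real.exp s * ∑ π, ∑ α, Real.exp (-s * X k y π α) := by
        rw [Finset.sum_congr rfl fun π _ => Finset.sum_comm, Finset.sum_comm]
        refine Finset.sum_congr rfl fun k _ => ?_
        rw [Finset.sum_congr rfl fun π _ => Finset.sum_comm, Finset.sum_comm]
        refine Finset.sum_congr rfl fun y _ => ?_
        rw [Finset.mul_sum]
        refine Finset.sum_congr rfl fun π _ => ?_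
        rw [Finset.mul_sum]
    _ ≤ ∑ k ∈ Finset.range (N + 1), ∑ y : Y, Real.exp s * M :=
        Finset.sum_le_sum fun k _ => Finset.sum_le_sum fun y _ =>
          mul_le_mul_of_nonneg_left (hX k y) (Real.exp_pos s).le
    _ = _ := by
        rw [Finset.sum_const, Finset.sum_const, Finset.card_range, Finset.card_univ,
          nsmul_eq_mul, nsmul_eq_mul]
        push_cast
        ring

/-- The run draws `α` before `π`, while the moment bound sums over `π` first; finite sums can be
exchanged. -/
theorem toOuterMeasure_uniform_bind_le [Nonempty Ω] [Nonempty Ω'] {β : Type*}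
    (P : Ω → Ω' → Prop) (f : Ω' → PMF β) (s : Set β) {δ : ℝ}
    (hP : ∑ π, ∑ α, badIndicator P π α ≤ Fintype.card Ω * (Fintype.card Ω' * δ))
    (hf : ∀ α, (f α).toOuterMeasure s ≤
      ∑ π, (Fintype.card Ω : ENNReal)⁻¹ * ENNReal.ofReal (badIndicator P π α)) :
    ((PMF.uniformOfFintype Ω').bind f).toOuterMeasure s ≤ ENNReal.ofReal δ := by
  set A := Fintype.card Ω with hA
  set B := Fintype.card Ω' with hB
  have hA0 : (A : ENNReal) ≠ 0 := by simp [hA]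
  have hB0 : (B : ENNReal) ≠ 0 := by simp [hB]
  rw [PMF.toOuterMeasure_bind_apply, tsum_fintype]
  calc _ ≤ ∑ α, (B : ENNReal)⁻¹ * ∑ π, (A : ENNReal)⁻¹ *
        ENNReal.ofReal (badIndicator P π α) := by
        refine Finset.sum_le_sum fun α _ => ?_
        rw [PMF.uniformOfFintype_apply]
        exact mul_le_mul_right (hf α) _
    _ = (B : ENNReal)⁻¹ * ((A : ENNReal)⁻¹ * ∑ π, ∑ α,
        ENNReal.ofReal (badIndicator P π α)) := by
        rw [Finset.sum_comm (s := (Finset.univ : Finset Ω)), ← Finset.mul_sum]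
        congr 1
        rw [Finset.mul_sum]
        refine Finset.sum_congr rfl fun α _ => ?_
        rw [Finset.mul_sum]
    _ = (B : ENNReal)⁻¹ * ((A : ENNReal)⁻¹ *
        ENNReal.ofReal (∑ π, ∑ α, badIndicator P π α)) := by
        rw [ENNReal.ofReal_sum_of_nonneg fun π _ => Finset.sum_nonneg fun α _ =>
          badIndicator_nonneg P π α]
        congr 2
        refine Finset.sum_congr rfl fun π _ => ?_
        rw [ENNReal.ofReal_sum_of_nonneg fun α _ => badIndicator_nonneg P π α]
    _ ≤ (B : ENNReal)⁻¹ * ((A : ENNReal)⁻¹ * ENNReal.ofReal (A * (B * δ))) :=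
        mul_le_mul_right (mul_le_mul_right (ENNReal.ofReal_le_ofReal hP) _) _
    _ = ENNReal.ofReal δ := by
        rw [ENNReal.ofReal_mul (Nat.cast_nonneg _), ENNReal.ofReal_mul (Nat.cast_nonneg _),
          ENNReal.ofReal_natCast, ENNReal.ofReal_natCast, ← mul_assoc (A : ENNReal)⁻¹,
          ENNReal.inv_mul_cancel hA0 (ENNReal.natCast_ne_top _), one_mul, ← mul_assoc,
          ENNReal.inv_mul_cancel hB0 (ENNReal.natCast_ne_top _), one_mul]

end UnionBound

/-! ### Failure probability of the whole run -/

theorem card_edge_le (F : Formula n) : Fintype.card (Edge F) ≤ 8 * n ^ 4 := by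
  have h1 : Fintype.card (Edge F) ≤ Fintype.card (Clause n × Fin n) := Fintype.card_subtype_le _
  have h2 : Fintype.card (Clause n) ≤ Fintype.card {C : Finset (Literal n) // C.card = 3} :=
    Fintype.card_subtype_mono _ _ fun C hC => hC.1
  rw [Fintype.card_finset_len, Fintype.card_prod, Fintype.card_fin, Fintype.card_bool] at h2
  rw [Fintype.card_prod, Fintype.card_fin] at h1
  calc _ ≤ _ := h1
    _ ≤ (n * 2) ^ 3 * n := Nat.mul_le_mul_right _ (h2.trans (Nat.choose_le_pow _ _))
    _ = _ := by ring

/-- With `s = 1 / 100` the three terms are at most about `-6.2e-4 * q`, `1e-4 * q` and `5e-5 * q`: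
the drift wins. -/
theorem Typical.exponent_le {q : ℝ} (hq : 0 ≤ q) {φ : Assignment n} (h : Typical q φ F)
    (y : Fin n) :
    ((supportEdges φ F y).card : ℝ) * (-(1 / 100) / 2 + (1 / 100) ^ 2 / 8) +
      (falseEdges φ F y).card * ((1 / 100) ^ 2 / 4) +
      ((falseEdges φ F y).card - (trueEdges φ F y).card : ℕ) * (1 / 100 / 2 + (1 / 100) ^ 2 / 8) ≤
    -(q / 1000000) := by
  have h1 := h.support y
  have h2 := h.falseClauses_le y
  have h3 := h.falseClauses_le_add y
  rw [← card_supportEdges] at h1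
  rw [← card_falseEdges h.subset] at h2 h3
  rw [← card_trueEdges] at h3
  have h4 : (((falseEdges φ F y).card - (trueEdges φ F y).card : ℕ) : ℝ) ≤ q / 100 := by
    rcases le_total (falseEdges φ F y).card (trueEdges φ F y).card with hle | hle
    · rw [Nat.sub_eq_zero_of_le hle]
      simp only [Nat.cast_zero]; positivity
    · rw [Nat.cast_sub hle]; linarith
  norm_num
  linarith

theorem Typical.sum_not_favourable_le {q : ℝ} (hq : 0 ≤ q) {φ : Assignment n}
    (h : Typical q φ F) :
    ∑ π : EdgeOrder F, ∑ α : Messages F, badIndicator (fun π α => Favourable φ α π) π α ≤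
      Fintype.card (EdgeOrder F) * (Fintype.card (Messages F) *
        ((8 * (n : ℝ) ^ 4 + 1) * n * 3 * Real.exp (-(q / 1000000)))) := by
  set M := Fintype.card (EdgeOrder F) * (Fintype.card (Messages F) *
    Real.exp (-(q / 1000000))) with hM
  have hcard : (Fintype.card (Edge F) : ℝ) ≤ 8 * (n : ℝ) ^ 4 := by
    exact_mod_cast card_edge_le F
  have hexp : Real.exp (1 / 100) ≤ 3 :=
    (Real.exp_le_exp.2 (by norm_num)).trans (Real.exp_one_lt_d9.le.trans (by norm_num))
  have hk : ∀ k y, ∑ π : EdgeOrder F, ∑ α : Messages F,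
      Real.exp (-(1 / 100) * margin φ (hybrid φ (firstEdges π k) α) y) ≤ M := by
    intro k y
    refine (sum_sum_exp_neg_mul_margin_le h.subset y (by norm_num) k).trans ?_
    rw [hM]
    gcongr
    exact h.exponent_le hq y
  have hM0 : 0 ≤ M := by rw [hM]; positivity
  calc _ ≤ (Fintype.card (Edge F) + 1) * (Fintype.card (Fin n)) * Real.exp (1 / 100) * M := by
        refine sum_badIndicator_le _ (fun k y (π : EdgeOrder F) (α : Messages F) =>
          margin φ (hybrid φ (firstEdges π k) α) y) (Fintype.card (Edge F)) (by norm_num)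
          (fun π α hf => ?_) hk
        unfold Favourable at hf
        push Not at hf
        obtain ⟨k, hk, y, hy⟩ := hf
        exact ⟨k, hk, y, Int.lt_add_one_iff.1 hy⟩
    _ ≤ (8 * (n : ℝ) ^ 4 + 1) * n * 3 * M := by
        rw [Fintype.card_fin]
        gcongr
    _ = _ := by rw [hM]; ring

theorem toOuterMeasure_loop_le (φ : Assignment n) (α : Messages F) :
    (loop 2 α).toOuterMeasure {o | o ≠ some fun x => some (φ x)} ≤
      ∑ π : EdgeOrder F, (Fintype.card (EdgeOrder F) : ENNReal)⁻¹ *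
        ENNReal.ofReal (badIndicator (fun π α => Favourable φ α π) π α) := by
  rw [loop, PMF.toOuterMeasure_bind_apply, tsum_fintype]
  refine Finset.sum_le_sum fun π _ => ?_
  rw [PMF.uniformOfFintype_apply]
  refine mul_le_mul_right ?_ _
  unfold badIndicator
  by_cases hf : Favourable φ α π
  · rw [if_pos hf, ENNReal.ofReal_zero, iteration_eq_target hf, toPartialAssignment_target hf.margin_target]
    refine le_of_eq ?_
    -- If the initial messages already equal the target, one iteration suffices; otherwise the
    -- second confirms the fixed point.
    split_ifs
    · rw [PMF.toOuterMeasure_pure_apply, if_neg (by simp)]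
    · rw [loop]
      simp only [iteration_target hf.margin_target, toPartialAssignment_target hf.margin_target,
        if_true, PMF.bind_const]
      rw [PMF.toOuterMeasure_pure_apply, if_neg (by simp)]
  · rw [if_neg hf, ENNReal.ofReal_one]
    exact toOuterMeasure_le_one _ _

theorem Typical.toOuterMeasure_warningPropagation_le {q : ℝ} (hq : 0 ≤ q) {φ : Assignment n}
    (h : Typical q φ F) :
    (warningPropagation F 2).toOuterMeasure {o | o ≠ some fun x => some (φ x)} ≤
      ENNReal.ofReal ((8 * (n : ℝ) ^ 4 + 1) * n * 3 * Real.exp (-(q / 1000000))) := by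
  unfold warningPropagation
  exact toOuterMeasure_uniform_bind_le (fun π α => Favourable φ α π) _ _
    (h.sum_not_favourable_le hq) fun α => toOuterMeasure_loop_le φ α

theorem toOuterMeasure_not_recoversPlanted_le (hn : 6 ≤ n) (p : unitInterval) :
    (plantedRun n p 2).toOuterMeasure (recoversPlanted n)ᶜ ≤
      ENNReal.ofReal ((1 + n * 3 + (8 * (n : ℝ) ^ 4 + 1) * n * 3) *
        Real.exp (-((p : ℝ) * (n : ℝ) ^ 2 / 1000000))) := by
  have hq : 0 ≤ (p : ℝ) * (n : ℝ) ^ 2 := mul_nonneg p.2.1 (by positivity)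
  unfold plantedRun
  set δ := ENNReal.ofReal ((1 + n * 3 + (8 * (n : ℝ) ^ 4 + 1) * n * 3) *
    Real.exp (-((p : ℝ) * (n : ℝ) ^ 2 / 1000000))) with hδ
  refine (toOuterMeasure_bind_le _ _ _ (fun _ => True) δ fun φ _ => ?_).trans (by simp)
  refine (toOuterMeasure_bind_le _ _ _ (Typical ((p : ℝ) * (n : ℝ) ^ 2) φ)
    (ENNReal.ofReal ((8 * (n : ℝ) ^ 4 + 1) * n * 3 *
      Real.exp (-((p : ℝ) * (n : ℝ) ^ 2 / 1000000)))) fun F hF => ?_).trans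
    ((add_le_add_left (toOuterMeasure_not_typical_le hn p φ) _).trans_eq ?_)
  · rw [PMF.toOuterMeasure_map_apply]
    exact hF.toOuterMeasure_warningPropagation_le hq
  · have h1 : (1 + n * 3 : ENNReal) = ENNReal.ofReal (1 + n * 3) := by
      rw [ENNReal.ofReal_add (by norm_num) (by positivity), ENNReal.ofReal_mul (by positivity)]
      simp
    rw [h1, ← ENNReal.ofReal_mul (by positivity), ← ENNReal.ofReal_add (by positivity)
      (by positivity), ← add_mul]

theorem failure_bound_le (hn : 6 ≤ n) {q : ℝ} (hq : 10000000 * Real.log n ≤ q) :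
    (1 + n * 3 + (8 * (n : ℝ) ^ 4 + 1) * n * 3) * Real.exp (-(q / 1000000)) ≤ 31 * (n : ℝ)⁻¹ := by
  have hn1 : (1 : ℝ) ≤ n := by exact_mod_cast (by omega : 1 ≤ n)
  have hn0 : (0 : ℝ) < n := by linarith
  -- The hypothesis even gives the power 10; 6 is enough against a prefactor of order `n ^ 5`.
  have h1 : Real.exp (-(q / 1000000)) ≤ ((n : ℝ) ^ 6)⁻¹ := by
    rw [← Real.exp_log (pow_pos hn0 6), ← Real.exp_neg, Real.log_pow]
    apply Real.exp_le_exp.2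
    have := Real.log_nonneg hn1
    push_cast
    linarith
  have h2 : 1 + n * 3 + (8 * (n : ℝ) ^ 4 + 1) * n * 3 ≤ 31 * (n : ℝ) ^ 5 := by
    have h3 : (n : ℝ) ≤ (n : ℝ) ^ 5 := le_self_pow₀ hn1 (by norm_num)
    have h4 : 8 * (n : ℝ) ^ 4 * n = 8 * (n : ℝ) ^ 5 := by ring
    nlinarith
  refine (mul_le_mul h2 h1 (Real.exp_pos _).le (by positivity)).trans_eq ?_
  field_simp

end WarningPropagation

theorem proposition2 :
    ∃ c₀ : ℝ, 0 < c₀ ∧ ∀ c : ℝ, c₀ ≤ c → ∀ p : ℕ → unitInterval,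
      (∀ᶠ n : ℕ in atTop, c * Real.log (n : ℝ) / (n : ℝ) ^ 2 ≤ (p n : ℝ)) →
      Tendsto
        (fun n : ℕ => (WarningPropagation.plantedRun n (p n) 2).toOuterMeasure
          (WarningPropagation.recoversPlanted n))
        atTop (𝓝 1) := by
  -- Any constant above `5 * 10 ^ 6` would beat the union bound.
  refine ⟨10000000, by norm_num, fun c hc p hp => ?_⟩
  have hlim : Tendsto (fun n : ℕ => 1 - ENNReal.ofReal (31 * (n : ℝ)⁻¹)) atTop (𝓝 1) := by
    have h1 : Tendsto (fun n : ℕ => 31 * (n : ℝ)⁻¹) atTop (𝓝 (31 * 0)) :=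
      (tendsto_inv_atTop_nhds_zero_nat (𝕜 := ℝ)).const_mul 31
    have h2 := ENNReal.Tendsto.sub (tendsto_const_nhds (x := (1 : ENNReal)))
      (ENNReal.tendsto_ofReal h1) (Or.inl ENNReal.one_ne_top)
    simpa using h2
  refine tendsto_of_tendsto_of_tendsto_of_le_of_le' hlim tendsto_const_nhds ?_
    (Eventually.of_forall fun n => WarningPropagation.toOuterMeasure_le_one _ _)
  filter_upwards [hp, eventually_ge_atTop 6] with n hpn hn
  refine le_trans ?_ (WarningPropagation.one_sub_le_toOuterMeasure _ _)
  refine tsub_le_tsub_left ((WarningPropagation.toOuterMeasure_not_recoversPlanted_le hn _).trans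
    (ENNReal.ofReal_le_ofReal (WarningPropagation.failure_bound_le hn ?_))) _
  have hn0 : (0 : ℝ) < n := by exact_mod_cast (by omega : 0 < n)
  have hlog : 0 ≤ Real.log n := Real.log_natCast_nonneg n
  rw [div_le_iff₀ (by positivity)] at hpn
  exact (mul_le_mul_of_nonneg_right hc hlog).trans hpn
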